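/- Let $B$ be a real separable Banach space with its Borel $\sigma$-algebra, and let $X, X_1, X_2, \dots$ be $B$-valued random variables on a probability space $(\Omega,\mathcal F,\mathbb P)$ such that $X_1, X_2, \dots$ are independent and each has the same distribution as $X$. Put $S_n = X_1 + \dots + X_n$ for $n \ge 1$. Suppose that there are positive integers $m_1 < m_2 < \cdots$ such that $S_{m_n}/\sqrt{m_n}$ converges weakly (to some Borel probability measure on $B$) as $n \to \infty$, but that the whole sequence $S_n/\sqrt n$ does not converge weakly to any Borel probability measure on $B$. Then, for every sequence $(a_n)_{n \ge 1}$ of positive real numbers, the sequence $S_n/a_n$ does not converge weakly to a non-degenerate Borel probability measure on $B$, that is, to one that is not a point mass. -/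

import Mathlib

open Filter MeasureTheory ProbabilityTheory

/-- The partial sum `S n` of the first `n` terms of a sequence of random vectors (the terms are
numbered from `0`, so `S n = X 0 + ... + X (n - 1)`). -/
def partialSum {Ω B : Type*} [AddCommMonoid B] (X : ℕ → Ω → B) (n : ℕ) (ω : Ω) : B :=
  ∑ i ∈ Finset.range n, X i ω

/-- The sequence `Y` of `B`-valued random variables on `(Ω, P)` converges weakly (in distribution)
to the Borel probability measure `ν` on `B`. -/
def ConvergesWeaklyTo {Ω B : Type*} [MeasurableSpace Ω] [TopologicalSpace B] [MeasurableSpace B]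
    [OpensMeasurableSpace B] (P : Measure Ω) [IsProbabilityMeasure P]
    (Y : ℕ → Ω → B) (ν : ProbabilityMeasure B) : Prop :=
  TendstoInDistribution Y atTop (id : B → B) (fun _ => P) (ν : Measure B)

/-- `Y` converges weakly to some Borel probability measure on `B`. -/
def ConvergesWeakly {Ω B : Type*} [MeasurableSpace Ω] [TopologicalSpace B] [MeasurableSpace B]
    [OpensMeasurableSpace B] (P : Measure Ω) [IsProbabilityMeasure P]
    (Y : ℕ → Ω → B) : Prop :=
  ∃ ν : ProbabilityMeasure B, ConvergesWeaklyTo P Y ν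

/-- The central limit theorem for (i.i.d. copies) `X 0, X 1, ...`:
`S n / √n` converges weakly. -/
def SatisfiesCLT {Ω B : Type*} [MeasurableSpace Ω] [NormedAddCommGroup B] [NormedSpace ℝ B]
    [MeasurableSpace B] [OpensMeasurableSpace B] (P : Measure Ω) [IsProbabilityMeasure P]
    (X : ℕ → Ω → B) : Prop :=
  ConvergesWeakly P (fun n ω => (Real.sqrt (n : ℝ))⁻¹ • partialSum X n ω)

/-- The central limit theorem for a subsequence: there are positive integers
`m 0 < m 1 < ...` such that `S (m n) / √(m n)` converges weakly. -/
def SatisfiesCLTSS {Ω B : Type*} [MeasurableSpace Ω] [NormedAddCommGroup B] [NormedSpace ℝ B]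
    [MeasurableSpace B] [OpensMeasurableSpace B] (P : Measure Ω) [IsProbabilityMeasure P]
    (X : ℕ → Ω → B) : Prop :=
  ∃ m : ℕ → ℕ, (∀ n, 0 < m n) ∧ StrictMono m ∧
    ConvergesWeakly P (fun n ω => (Real.sqrt (m n : ℝ))⁻¹ • partialSum X (m n) ω)

/-- A probability measure is non-degenerate if it is not a point mass. -/
def IsNondegenerate {B : Type*} [MeasurableSpace B] (ν : ProbabilityMeasure B) : Prop :=
  ∀ b : B, (ν : Measure B) ≠ Measure.dirac b

open scoped Topology NNReal

/-! ### Second moments from characteristic functions. -/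

section CharFun

/-! Everything is decided by one functional `f` under which the limit `ν` of `S_n / a_n` is not a
point mass; it exists by `exists_eq_dirac_of_forall_map_eq_dirac`. Convergence of `f(S_m) / √m`
along the subsequence forces `f(X)` to be square integrable and centred, so the real central limit
theorem gives `f(S_n) / √n` a Gaussian limit along all `n`. Its variance is nonzero, since otherwise
`f(S_n) / a_n` would vanish almost surely. Convergence of types then yields `√n / a_n → d > 0`, and
Slutsky's theorem in `B` turns convergence of `S_n / a_n` into convergence of `S_n / √n`, a
contradiction.

The second moment comes from symmetrization: a lower bound on `|φ(t/√m)|^(2m)` bounds `m E(1 -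
cos(t(X - X')/√m))`, with `X'` an independent copy of `X`, and Fatou's lemma bounds `E(X - X')²`. -/

theorem integral_one_sub_cos_mul_sub (μ : Measure ℝ) [IsProbabilityMeasure μ] (s : ℝ) :
    ∫ p : ℝ × ℝ, (1 - Real.cos (s * (p.1 - p.2))) ∂(μ.prod μ) = 1 - ‖charFun μ s‖ ^ 2 := by
  have hprod : (∫ p : ℝ × ℝ, Complex.exp ((s * (p.1 - p.2) : ℝ) * Complex.I) ∂(μ.prod μ))
      = ((‖charFun μ s‖ ^ 2 : ℝ) : ℂ) := by
    have h := integral_prod_mul (μ := μ) (ν := μ)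
      (fun x : ℝ => Complex.exp (s * x * Complex.I))
      (fun y : ℝ => Complex.exp ((-s : ℝ) * y * Complex.I))
    rw [← charFun_apply_real, ← charFun_apply_real, charFun_neg, Complex.mul_conj'] at h
    rw [Complex.ofReal_pow, ← h]
    refine integral_congr_ae (ae_of_all _ fun p => ?_)
    simp only
    rw [← Complex.exp_add]
    congr 1
    push_cast
    ring
  have hint : Integrable (fun p : ℝ × ℝ => Complex.exp ((s * (p.1 - p.2) : ℝ) * Complex.I))
      (μ.prod μ) :=
    Integrable.of_bound (by fun_prop) 1 (ae_of_all _ fun p => by rw [Complex.norm_exp_ofReal_mul_I])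
  have hcos : ∫ p : ℝ × ℝ, Real.cos (s * (p.1 - p.2)) ∂(μ.prod μ) = ‖charFun μ s‖ ^ 2 := by
    have h := congrArg Complex.re hprod
    rw [Complex.ofReal_re, ← RCLike.re_eq_complex_re, ← integral_re hint] at h
    simpa only [RCLike.re_eq_complex_re, Complex.exp_ofReal_mul_I_re] using h
  rw [integral_sub (integrable_const _), hcos]
  · simp
  · exact Integrable.of_bound (by fun_prop) 1 (ae_of_all _ fun p => by
      rw [Real.norm_eq_abs]; exact Real.abs_cos_le_one _)

theorem exists_ne_zero_half_lt_norm_charFun (ρ : Measure ℝ) [IsProbabilityMeasure ρ] :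
    ∃ t : ℝ, t ≠ 0 ∧ 1 / 2 < ‖charFun ρ t‖ := by
  have hc : Continuous fun t => ‖charFun ρ t‖ := continuous_charFun.norm
  have h0 : ∀ᶠ t in 𝓝 (0 : ℝ), 1 / 2 < ‖charFun ρ t‖ :=
    hc.continuousAt.eventually_const_lt (by simp; norm_num)
  have h1 : ∀ᶠ t in 𝓝[≠] (0 : ℝ), 1 / 2 < ‖charFun ρ t‖ := h0.filter_mono nhdsWithin_le_nhds
  obtain ⟨t, ht, ht'⟩ := (h1.and self_mem_nhdsWithin).exists
  exact ⟨t, ht', ht⟩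

theorem mul_one_sub_le_neg_log_of_le_pow {x c : ℝ} {n : ℕ} (hx : 0 ≤ x) (hc : 0 < c) (h : c ≤ x ^ n) :
    n * (1 - x) ≤ -Real.log c := by
  have h1 : x ^ n ≤ Real.exp (-(n * (1 - x))) := by
    calc x ^ n ≤ (Real.exp (-(1 - x))) ^ n := by
          gcongr
          linarith [Real.add_one_le_exp (-(1 - x))]
      _ = _ := by rw [← Real.exp_nat_mul]; ring_nf
  have h2 := Real.log_le_log hc (h.trans h1)
  rw [Real.log_exp] at h2
  linarith

/-- By Fubini, `x - y` is square integrable in `x` for some fixed `y`; adding that constant back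
changes nothing. -/
theorem memLp_two_of_memLp_two_sub {μ : Measure ℝ} [IsProbabilityMeasure μ]
    (h : MemLp (fun p : ℝ × ℝ => p.1 - p.2) 2 (μ.prod μ)) : MemLp (fun x : ℝ => x) 2 μ := by
  have h1 := (memLp_two_iff_integrable_sq h.1).1 h
  have h2 := h1.prod_left_ae
  obtain ⟨y, hy⟩ := h2.exists
  have h3 : MemLp (fun x : ℝ => x - y) 2 μ := (memLp_two_iff_integrable_sq (by fun_prop)).2 hy
  exact (h3.add (memLp_const y)).ae_eq (ae_of_all _ fun x => by simp)

/-- If the powers `φ (t / √m) ^ m` of a characteristic function converge to a characteristic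
function along some sequence `m → ∞`, then the underlying measure has a second moment. -/
theorem memLp_two_of_tendsto_charFun_pow {μ ρ : Measure ℝ} [IsProbabilityMeasure μ]
    [IsProbabilityMeasure ρ] {m : ℕ → ℕ} (hm : Tendsto m atTop atTop)
    (h : ∀ t : ℝ, Tendsto (fun n => charFun μ ((√(m n))⁻¹ * t) ^ m n) atTop (𝓝 (charFun ρ t))) :
    MemLp (fun x : ℝ => x) 2 μ := by
  obtain ⟨t, ht0, ht⟩ := exists_ne_zero_half_lt_norm_charFun ρ
  -- Here `1 / 4` is the square of the lower bound `1 / 2` for the limiting modulus.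
  set C : ℝ := -Real.log (1 / 4)
  let F : ℕ → ℝ × ℝ → ℝ := fun n p => m n * (1 - Real.cos ((√(m n))⁻¹ * t * (p.1 - p.2)))
  have hF0 : ∀ n p, 0 ≤ F n p := fun n p =>
    mul_nonneg (Nat.cast_nonneg _) (by linarith [Real.cos_le_one ((√(m n))⁻¹ * t * (p.1 - p.2))])
  have hFm : ∀ n, Measurable (F n) := fun n => by fun_prop
  have hFi : ∀ n, Integrable (F n) (μ.prod μ) := fun n => by
    refine Integrable.const_mul ((integrable_const _).sub ?_) _
    exact Integrable.of_bound (by fun_prop) 1 (ae_of_all _ fun p => by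
      rw [Real.norm_eq_abs]; exact Real.abs_cos_le_one _)
  have hFC : ∀ᶠ n in atTop, ∫ p, F n p ∂(μ.prod μ) ≤ C := by
    filter_upwards [(h t).norm.eventually_const_lt ht] with n hn
    rw [integral_const_mul, integral_one_sub_cos_mul_sub]
    refine mul_one_sub_le_neg_log_of_le_pow (by positivity) (by norm_num) ?_
    rw [norm_pow] at hn
    rw [pow_right_comm]
    calc (1 / 4 : ℝ) = (1 / 2) ^ 2 := by norm_num
      _ ≤ _ := by gcongr
  have hsqrt : Tendsto (fun n => √(m n : ℝ)) atTop atTop :=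
    Real.tendsto_sqrt_atTop.comp (tendsto_natCast_atTop_atTop.comp hm)
  -- Since `1 - cos u ≥ 2u²/π²` for `|u| ≤ π`, each `F n p` dominates `G p` once `√(m n)` is large,
  -- so Fatou applies.
  let G : ℝ × ℝ → ℝ := fun p => 2 / Real.pi ^ 2 * t ^ 2 * (p.1 - p.2) ^ 2
  have hGF : ∀ p, ENNReal.ofReal (G p) ≤ liminf (fun n => ENNReal.ofReal (F n p)) atTop := by
    intro p
    refine le_liminf_of_le (by isBoundedDefault) ?_
    filter_upwards [hsqrt.eventually_ge_atTop (|t * (p.1 - p.2)| / Real.pi),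
      hsqrt.eventually_gt_atTop 0] with n hn hn0
    refine ENNReal.ofReal_le_ofReal ?_
    have habs : |(√(m n))⁻¹ * t * (p.1 - p.2)| ≤ Real.pi := by
      rw [mul_assoc, abs_mul, abs_of_pos (inv_pos.2 hn0), inv_mul_le_iff₀ hn0]
      rwa [div_le_iff₀ Real.pi_pos] at hn
    have hcos := Real.cos_le_one_sub_mul_cos_sq habs
    have hm0 : (0 : ℝ) < m n := Real.sqrt_pos.1 hn0
    calc G p = m n * (2 / Real.pi ^ 2 * ((√(m n))⁻¹ * t * (p.1 - p.2)) ^ 2) := by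
          simp only [G, mul_pow, inv_pow, Real.sq_sqrt hm0.le]
          field_simp
      _ ≤ F n p := by
          simp only [F]
          gcongr
          linarith
  have hG : ∫⁻ p, ENNReal.ofReal (G p) ∂(μ.prod μ) ≤ ENNReal.ofReal C := by
    calc _ ≤ ∫⁻ p, liminf (fun n => ENNReal.ofReal (F n p)) atTop ∂(μ.prod μ) :=
          lintegral_mono hGF
      _ ≤ liminf (fun n => ∫⁻ p, ENNReal.ofReal (F n p) ∂(μ.prod μ)) atTop :=
          lintegral_liminf_le fun n => (hFm n).ennreal_ofReal
      _ ≤ ENNReal.ofReal C := by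
          refine liminf_le_of_frequently_le' (Eventually.frequently ?_)
          filter_upwards [hFC] with n hn
          rw [← ofReal_integral_eq_lintegral_ofReal (hFi n) (ae_of_all _ (hF0 n))]
          exact ENNReal.ofReal_le_ofReal hn
  have hGi : Integrable G (μ.prod μ) := by
    refine ⟨by fun_prop, ?_⟩
    rw [hasFiniteIntegral_iff_ofReal (ae_of_all _ fun p => by positivity)]
    exact hG.trans_lt ENNReal.ofReal_lt_top
  refine memLp_two_of_memLp_two_sub ((memLp_two_iff_integrable_sq (by fun_prop)).2 ?_)
  have hk : 2 / Real.pi ^ 2 * t ^ 2 ≠ 0 := by positivity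
  exact (integrable_const_mul_iff (isUnit_iff_ne_zero.2 hk) _).1 hGi

end CharFun

/-! ### Point masses detected by functionals. -/

section Dirac

variable {B : Type*} [NormedAddCommGroup B] [NormedSpace ℝ B] [CompleteSpace B]
  [TopologicalSpace.SeparableSpace B] [MeasurableSpace B] [BorelSpace B]

/-- A probability measure on a separable Banach space all of whose one-dimensional projections are
point masses is a point mass. -/
theorem exists_eq_dirac_of_forall_map_eq_dirac {ν : Measure B} [IsProbabilityMeasure ν]
    (h : ∀ f : StrongDual ℝ B, ∃ c : ℝ, ν.map f = Measure.dirac c) :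
    ∃ b : B, ν = Measure.dirac b := by
  have : SecondCountableTopology B := UniformSpace.secondCountable_of_separable B
  -- The difference of two independent copies is killed almost surely by each functional, so its
  -- characteristic function is `1`.
  have hsub : (ν.prod ν).map (fun p : B × B => p.1 - p.2) = Measure.dirac 0 := by
    have hmeas : Measurable (fun p : B × B => p.1 - p.2) := by fun_prop
    have : IsProbabilityMeasure ((ν.prod ν).map (fun p : B × B => p.1 - p.2)) :=
      Measure.isProbabilityMeasure_map hmeas.aemeasurable
    refine Measure.ext_of_charFunDual (funext fun f => ?_)
    obtain ⟨c, hc⟩ := h f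
    have hfc : ∀ᵐ x ∂ν, f x = c := by
      have : ∀ᵐ y ∂(ν.map f), y = c := by rw [hc]; simp [ae_dirac_eq]
      exact ae_of_ae_map (by fun_prop) this
    rw [charFunDual_apply, charFunDual_apply, integral_map (by fun_prop)
      (Measurable.aestronglyMeasurable (by fun_prop))]
    have hae : ∀ᵐ p ∂(ν.prod ν), Complex.exp (f (p.1 - p.2) * Complex.I) = 1 := by
      filter_upwards [Measure.quasiMeasurePreserving_fst.ae hfc,
        Measure.quasiMeasurePreserving_snd.ae hfc] with p h1 h2
      simp [h1, h2]
    rw [integral_congr_ae hae]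
    simp
  have hae : ∀ᵐ p ∂(ν.prod ν), p.1 - p.2 = 0 := by
    have : ∀ᵐ y ∂((ν.prod ν).map (fun p : B × B => p.1 - p.2)), y = 0 := by
      rw [hsub]; simp [ae_dirac_eq]
    exact ae_of_ae_map (by fun_prop) this
  obtain ⟨b, hb⟩ := (Measure.ae_ae_of_ae_prod hae).exists
  refine ⟨b, ?_⟩
  have hb' : (fun x => x) =ᵐ[ν] fun _ => b := by
    filter_upwards [hb] with y hy using (sub_eq_zero.1 hy).symm
  calc ν = ν.map (fun x => x) := Measure.map_id'.symm
    _ = ν.map (fun _ => b) := Measure.map_congr hb'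
    _ = Measure.dirac b := by rw [Measure.map_const]; simp

end Dirac

/-! ### Scaling and limits in distribution. -/

section TendstoInDistribution

variable {Ω Ω' : Type*} {mΩ : MeasurableSpace Ω} {mΩ' : MeasurableSpace Ω'}
  {P : Measure Ω} [IsProbabilityMeasure P] {P' : Measure Ω'} [IsProbabilityMeasure P']

theorem MeasureTheory.TendstoInDistribution.comp_tendsto {E : Type*} [TopologicalSpace E]
    [MeasurableSpace E] [OpensMeasurableSpace E] {T : ℕ → Ω → E} {Z : Ω' → E}
    (h : TendstoInDistribution T atTop Z (fun _ => P) P') {φ : ℕ → ℕ}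
    (hφ : Tendsto φ atTop atTop) :
    TendstoInDistribution (fun n => T (φ n)) atTop Z (fun _ => P) P' where
  forall_aemeasurable n := h.forall_aemeasurable (φ n)
  aemeasurable_limit := h.aemeasurable_limit
  tendsto := h.tendsto.comp hφ

/-- Slutsky's theorem for multiplication by a convergent sequence of scalars. -/
theorem MeasureTheory.TendstoInDistribution.smul_of_tendsto {E : Type*} [NormedAddCommGroup E]
    [NormedSpace ℝ E] [SecondCountableTopology E] [MeasurableSpace E] [BorelSpace E]
    {T : ℕ → Ω → E} {Z : Ω' → E} (h : TendstoInDistribution T atTop Z (fun _ => P) P')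
    {c : ℕ → ℝ} {d : ℝ} (hc : Tendsto c atTop (𝓝 d)) :
    TendstoInDistribution (fun n ω => c n • T n ω) atTop (fun ω => d • Z ω) (fun _ => P) P' := by
  refine h.continuous_comp_prodMk_of_tendstoInMeasure_const (g := fun p : E × ℝ => p.2 • p.1)
    (by fun_prop) (Y := fun n _ => c n) (c := d) ?_ (fun n => aemeasurable_const)
  exact tendstoInMeasure_of_tendsto_ae (fun n => aestronglyMeasurable_const)
    (ae_of_all _ fun _ => hc)

/-- If normalized i.i.d. sums converge in distribution along a subsequence, then the
summands are square integrable and centred. -/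
theorem memLp_two_and_integral_eq_zero_of_tendstoInDistribution {Y : ℕ → Ω → ℝ} {Z : Ω' → ℝ}
    (hindep : iIndepFun Y P) (hident : ∀ i, IdentDistrib (Y i) (Y 0) P P)
    {m : ℕ → ℕ} (hm : Tendsto m atTop atTop)
    (h : TendstoInDistribution (fun n ω => (√(m n))⁻¹ * ∑ i ∈ Finset.range (m n), Y i ω) atTop Z
      (fun _ => P) P') :
    MemLp (Y 0) 2 P ∧ P[Y 0] = 0 := by
  have hY := (hident 0).aemeasurable_fst
  have : IsProbabilityMeasure (P.map (Y 0)) := Measure.isProbabilityMeasure_map hY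
  have : IsProbabilityMeasure (P'.map Z) := Measure.isProbabilityMeasure_map h.aemeasurable_limit
  have hL2 : MemLp (Y 0) 2 P := by
    have h1 : MemLp (fun x : ℝ => x) 2 (P.map (Y 0)) := by
      refine memLp_two_of_tendsto_charFun_pow (ρ := P'.map Z) hm fun t => ?_
      have h2 := ProbabilityMeasure.tendsto_iff_tendsto_charFun.1 h.tendsto t
      refine h2.congr fun n => ?_
      exact charFun_inv_sqrt_mul_sum hindep hident
    exact (memLp_map_measure_iff (by fun_prop) hY).1 h1
  refine ⟨hL2, ?_⟩
  have hint : Integrable (Y 0) P := hL2.integrable (by norm_num)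
  have hslln := strong_law_ae_real Y hint (fun i j hij => hindep.indepFun hij) hident
  have hmR : Tendsto (fun n => (m n : ℝ)) atTop atTop := tendsto_natCast_atTop_atTop.comp hm
  -- `S_m / m` has two limits: the mean, by the strong law, and `0`, being `1/√m` times a convergent
  -- sequence.
  have hlim : TendstoInDistribution
      (fun n ω => (√(m n : ℝ))⁻¹ • ((√(m n))⁻¹ * ∑ i ∈ Finset.range (m n), Y i ω)) atTop
      (fun _ => P[Y 0]) (fun _ => P) P := by
    refine tendstoInDistribution_of_ae_tendsto
      (fun n => (h.forall_aemeasurable n).const_mul _) aemeasurable_const ?_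
    filter_upwards [hslln] with ω hω
    refine (hω.comp hm).congr fun n => ?_
    simp only [Function.comp_apply, smul_eq_mul]
    rw [← mul_assoc, ← mul_inv, Real.mul_self_sqrt (Nat.cast_nonneg _), div_eq_inv_mul]
  have hzero := h.smul_of_tendsto
    (tendsto_inv_atTop_zero.comp (Real.tendsto_sqrt_atTop.comp hmR))
  have hu := tendstoInDistribution_unique _ hlim hzero
  simp only [zero_smul, Measure.map_const, measure_univ, one_smul] at hu
  exact dirac_eq_dirac_iff.1 hu

/-- **Convergence of types** for a Gaussian limit: positive scaling factors that turn a sequence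
with a non-degenerate centred Gaussian limit into one with a limit other than `0` converge to a
positive number. -/
theorem exists_pos_tendsto_of_tendstoInDistribution_mul {T : ℕ → Ω → ℝ} {v : ℝ≥0} (hv : v ≠ 0)
    (hT : TendstoInDistribution T atTop id (fun _ => P) (gaussianReal 0 v)) {e : ℕ → ℝ}
    (he : ∀ n, 0 < e n) {Z : Ω' → ℝ} (hZ : P'.map Z ≠ Measure.dirac 0)
    (hU : TendstoInDistribution (fun n ω => e n * T n ω) atTop Z (fun _ => P) P') :
    ∃ d : ℝ, 0 < d ∧ Tendsto e atTop (𝓝 d) := by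
  have hgauss : ∀ {φ : ℕ → ℕ} {d : ℝ}, Tendsto φ atTop atTop →
      Tendsto (fun n => e (φ n)) atTop (𝓝 d) →
      P'.map Z = gaussianReal 0 (.mk (d ^ 2) (sq_nonneg _) * v) := by
    intro φ d hφ hd
    have h1 := (hT.comp_tendsto hφ).smul_of_tendsto hd
    have h2 := tendstoInDistribution_unique _ (hU.comp_tendsto hφ) h1
    rw [h2]
    simpa using! gaussianReal_map_const_mul (μ := 0) (v := v) d
  have hne : ∀ {φ : ℕ → ℕ} {d : ℝ}, Tendsto φ atTop atTop →
      Tendsto (fun n => e (φ n)) atTop (𝓝 d) → d ≠ 0 := by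
    rintro φ d hφ hd rfl
    refine hZ ((hgauss hφ hd).trans ?_)
    rw [← gaussianReal_zero_var]
    congr 1
    ext
    simp
  have hbdd : ∃ M : ℝ, ∀ᶠ n in atTop, e n ∈ Set.Icc 0 M := by
    -- If `1 / e` clustered at `0`, then `T = (1 / e) • (e T)` would tend to `0` along a
    -- subsequence, against its nondegenerate limit.
    have hcl : ¬ MapClusterPt 0 atTop (fun n => (e n)⁻¹) := by
      intro hcl
      obtain ⟨φ, hφ, hlim⟩ := hcl.tendsto_subseq
      have h1 := (hU.comp_tendsto hφ.tendsto_atTop).smul_of_tendsto hlim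
      have h2 : TendstoInDistribution (fun n => T (φ n)) atTop (fun ω => (0 : ℝ) • Z ω)
          (fun _ => P) P' := by
        refine h1.congr (fun n => ae_of_all _ fun ω => ?_) (ae_eq_refl _)
        simp [(he (φ n)).ne']
      have h3 := tendstoInDistribution_unique _ (hT.comp_tendsto hφ.tendsto_atTop) h2
      simp only [zero_smul, Measure.map_const, measure_univ, one_smul, Measure.map_id] at h3
      rw [← gaussianReal_zero_var, gaussianReal_ext_iff] at h3
      exact hv h3.2
    rw [mapClusterPt_iff_frequently] at hcl
    push Not at hcl
    obtain ⟨s, hs, hev⟩ := hcl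
    obtain ⟨ε, hε, hεs⟩ := Metric.mem_nhds_iff.1 hs
    refine ⟨ε⁻¹, ?_⟩
    filter_upwards [hev] with n hn
    refine ⟨(he n).le, ?_⟩
    have h1 : ε ≤ (e n)⁻¹ := by
      by_contra! hlt
      refine hn (hεs ?_)
      rwa [Metric.mem_ball, dist_zero_right, Real.norm_eq_abs, abs_of_pos (inv_pos.2 (he n))]
    rwa [le_inv_comm₀ (he n) hε]
  obtain ⟨M, hM⟩ := hbdd
  obtain ⟨d, hd, φ, hφ, hlim⟩ := isCompact_Icc.tendsto_subseq' hM.frequently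
  have hd0 : 0 < d := lt_of_le_of_ne hd.1 (hne hφ.tendsto_atTop hlim).symm
  refine ⟨d, hd0, isCompact_Icc.tendsto_nhds_of_unique_mapClusterPt hM fun x hx hcl => ?_⟩
  obtain ⟨ψ, hψ, hlim'⟩ := hcl.tendsto_subseq
  -- Both cluster points give the limit law the same variance, so their squares agree.
  have h1 := (hgauss hψ.tendsto_atTop hlim').symm.trans (hgauss hφ.tendsto_atTop hlim)
  rw [gaussianReal_ext_iff] at h1
  have h2 := congrArg NNReal.toReal (mul_right_cancel₀ hv h1.2)
  exact (pow_left_inj₀ hx.1 hd0.le two_ne_zero).1 h2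

end TendstoInDistribution

/-! ### The theorem in Banach space. -/

theorem theorem2 {B : Type*} [NormedAddCommGroup B] [NormedSpace ℝ B] [CompleteSpace B]
    [TopologicalSpace.SeparableSpace B] [MeasurableSpace B] [BorelSpace B]
    {Ω : Type*} [MeasurableSpace Ω] (P : Measure Ω) [IsProbabilityMeasure P]
    (X : Ω → B) (Xs : ℕ → Ω → B)
    (hX : Measurable X) (hXs : ∀ n, Measurable (Xs n))
    (hindep : iIndepFun Xs P) (hident : ∀ n, IdentDistrib (Xs n) X P P)
    (hCLTSS : SatisfiesCLTSS P Xs) (hCLT : ¬ SatisfiesCLT P Xs)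
    (a : ℕ → ℝ) (ha : ∀ n, 0 < n → 0 < a n) :
    ¬ ∃ ν : ProbabilityMeasure B, IsNondegenerate ν ∧
      ConvergesWeaklyTo P (fun n ω => (a n)⁻¹ • partialSum Xs n ω) ν := by
  rintro ⟨ν, hν, hconv⟩
  apply hCLT
  obtain ⟨m, -, hm, ρ, hρ⟩ := hCLTSS
  unfold ConvergesWeaklyTo at hconv hρ
  have : SecondCountableTopology B := UniformSpace.secondCountable_of_separable B
  obtain ⟨f, hf⟩ : ∃ f : StrongDual ℝ B, ∀ c : ℝ, (ν : Measure B).map f ≠ Measure.dirac c := by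
    by_contra! hcon
    obtain ⟨b, hb⟩ := exists_eq_dirac_of_forall_map_eq_dirac hcon
    exact hν b hb
  let Y : ℕ → Ω → ℝ := fun i ω => f (Xs i ω)
  have hYindep : iIndepFun Y P := hindep.comp (fun _ => f) (fun _ => by fun_prop)
  have hYident : ∀ i, IdentDistrib (Y i) (Y 0) P P := fun i =>
    ((hident i).trans (hident 0).symm).comp (u := f) (by fun_prop)
  have hfsum : ∀ (c : ℝ) (n : ℕ) (ω : Ω),
      f (c • partialSum Xs n ω) = c * ∑ i ∈ Finset.range n, Y i ω := by
    intro c n ω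
    simp [partialSum, Y]
  have hYm : TendstoInDistribution (fun n ω => (√(m n))⁻¹ * ∑ i ∈ Finset.range (m n), Y i ω)
      atTop (f ∘ id) (fun _ => P) (ρ : Measure B) := by
    refine (hρ.continuous_comp f.continuous).congr (fun n => ae_of_all _ fun ω => ?_)
      (ae_eq_refl _)
    exact hfsum _ _ _
  obtain ⟨hL2, hmean⟩ := memLp_two_and_integral_eq_zero_of_tendstoInDistribution hYindep hYident
    hm.tendsto_atTop hYm
  have hYa : TendstoInDistribution (fun n ω => (a n)⁻¹ * ∑ i ∈ Finset.range n, Y i ω)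
      atTop (f ∘ id) (fun _ => P) (ν : Measure B) := by
    refine (hconv.continuous_comp f.continuous).congr (fun n => ae_of_all _ fun ω => ?_)
      (ae_eq_refl _)
    exact hfsum _ _ _
  have hvar : Var[Y 0; P].toNNReal ≠ 0 := by
    intro h0
    have h1 : Var[Y 0; P] = 0 := le_antisymm (Real.toNNReal_eq_zero.1 h0) (variance_nonneg _ _)
    have h2 : ∀ i, ∀ᵐ ω ∂P, Y i ω = 0 := by
      intro i
      have hi := ae_eq_integral_of_variance_eq_zero
        ((hYident i).memLp_iff.2 hL2) ((hYident i).variance_eq.trans h1)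
      rwa [(hYident i).integral_eq, hmean] at hi
    have h3 : TendstoInDistribution (fun n ω => (a n)⁻¹ * ∑ i ∈ Finset.range n, Y i ω)
        atTop (fun _ => (0 : ℝ)) (fun _ => P) P := by
      refine (tendstoInDistribution_const aemeasurable_const).congr (fun n => ?_) (ae_eq_refl _)
      filter_upwards [ae_all_iff.2 h2] with ω hω
      simp [hω]
    have h4 := tendstoInDistribution_unique _ hYa h3
    refine hf 0 (h4.trans ?_)
    simp [Measure.map_const]
  have hclt := tendstoInDistribution_inv_sqrt_mul_sum_sub
    (Y := id) (P' := gaussianReal 0 Var[Y 0; P].toNNReal) HasLaw.id hL2 hYindep hYident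
  simp only [hmean, mul_zero, sub_zero] at hclt
  -- The shift avoids index `0`, where `a` need not be positive and `√0 = 0` would make the scaling
  -- factor vanish.
  have hsucc : Tendsto (fun n : ℕ => n + 1) atTop atTop := tendsto_add_atTop_nat 1
  have hsq : ∀ n : ℕ, (0 : ℝ) < √((n + 1 : ℕ) : ℝ) := fun n => Real.sqrt_pos.2 (by positivity)
  obtain ⟨d, hd0, hd⟩ := exists_pos_tendsto_of_tendstoInDistribution_mul hvar
    (hclt.comp_tendsto hsucc) (e := fun n => (a (n + 1))⁻¹ * √((n + 1 : ℕ) : ℝ))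
    (fun n => mul_pos (inv_pos.2 (ha _ n.succ_pos)) (hsq n)) (hf 0)
    ((hYa.comp_tendsto hsucc).congr (fun n => ae_of_all _ fun ω => by
      simp only
      rw [mul_assoc, mul_inv_cancel_left₀ (hsq n).ne']) (ae_eq_refl _))
  have hscaled : TendstoInDistribution
      (fun n ω => (√((n + 1 : ℕ) : ℝ))⁻¹ • partialSum Xs (n + 1) ω) atTop
      (fun x => d⁻¹ • id x) (fun _ => P) (ν : Measure B) := by
    refine ((hconv.comp_tendsto hsucc).smul_of_tendsto (hd.inv₀ hd0.ne')).congr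
      (fun n => ae_of_all _ fun ω => ?_) (ae_eq_refl _)
    simp only
    rw [smul_smul, mul_inv_rev, inv_inv, mul_assoc,
      mul_inv_cancel₀ (ha _ (Nat.succ_pos _)).ne', mul_one]
  refine ⟨ν.map (f := fun x => d⁻¹ • id x) (by fun_prop), ?_⟩
  have hmeas : ∀ n : ℕ, Measurable fun ω => (√(n : ℝ))⁻¹ • partialSum Xs n ω := fun n => by
    unfold partialSum
    fun_prop
  refine ⟨fun n => (hmeas n).aemeasurable, aemeasurable_id, ?_⟩
  refine (tendsto_add_atTop_iff_nat 1).1 ?_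
  convert! hscaled.tendsto using 2
  simp
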